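/- Let $G=(V,E)$ be a finite simple graph on $n$ nodes. For $S\subseteq V$ let $\partial S$ be the set of nodes outside $S$ that have a neighbour in $S$. For real $\phi,\alpha$, call $G$ a $(\phi,\alpha)$-expander if $|\partial S|/|S|\ge\phi$ for every $S\subseteq V$ with $0<|S|\le\alpha n$. In the $k$-PUSH&PULL protocol one node $s$ initially knows a rumor; in each synchronous round every node independently samples $k$ of its neighbours uniformly at random with replacement (a node without neighbours makes no calls), every informed node informs all nodes it sampled (PUSH), and every uninformed node that sampled at least one informed node becomes informed (PULL). Let $T_s\in\mathbb N\cup\{\infty\}$ be the number of rounds until all nodes are informed. **Theorem.** For every $\phi_0>1$ and every $\gamma>0$ there is a constant $c>0$ (depending only on $\phi_0$ and $\gamma$) such that for all integers $n\ge 1$ and $k\ge 2$ and all real $\phi\ge\phi_0$ and $\alpha\le\frac{1}{1+1.6\phi}$ there exists a $(\phi,\alpha)$-expander $G$ on $n$ nodes such that, for every initially informed node $s$, $$\Pr\big[\,T_s\ \ge\ c\,(\log_\phi n+\log_k n)\,\big]\ \ge\ 1-n^{-\gamma}.$$ In other words, for $\phi$ bounded away from $1$, rumor spreading with $k$-PUSH&PULL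 on $G$ requires $\Omega(\log_\phi n+\log_k n)$ rounds with high probability. -/

import Mathlib

open MeasureTheory
open scoped ENNReal

/-- The vertex boundary of `S`: the nodes outside `S` that have a neighbour in `S`. -/
def vertexBoundary {V : Type*} (G : SimpleGraph V) (S : Set V) : Set V :=
  {v | v ∉ S ∧ ∃ s ∈ S, G.Adj s v}

/-- `G` is a `(φ, α)`-(vertex) expander: every set `S` of nodes with `0 < |S| ≤ α n` satisfies
`|∂S| / |S| ≥ φ`, where `n` is the number of nodes. -/
def IsVertexExpander {V : Type*} [Fintype V] (G : SimpleGraph V) (φ α : ℝ) : Prop :=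
  ∀ S : Finset V, 0 < S.card → (S.card : ℝ) ≤ α * (Fintype.card V : ℝ) →
    φ ≤ ((vertexBoundary G (S : Set V)).ncard : ℝ) / (S.card : ℝ)

open Classical in
/-- The nodes that `v` may call: its neighbours. A node without neighbours is given the single
option of calling itself; such a call transmits nothing, so it amounts to making no call. -/
noncomputable def callees {V : Type*} [Fintype V] (G : SimpleGraph V) (v : V) : Finset V :=
  if ∃ w, G.Adj v w then Finset.univ.filter (fun w => G.Adj v w) else {v}

theorem callees_nonempty {V : Type*} [Fintype V] (G : SimpleGraph V) (v : V) :
    (callees G v).Nonempty := by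
  unfold callees
  split_ifs with h
  · obtain ⟨w, hw⟩ := h
    exact ⟨w, by simpa using hw⟩
  · exact Finset.singleton_nonempty v

/-- A realization of all calls: `ω t v i` is the node that `v` contacts with the `i`-th of its
`k` calls in round `t`. -/
abbrev Calls (V : Type*) (k : ℕ) : Type _ := ℕ → V → Fin k → V

/-- The law of the calls of one round: every node makes `k` calls, each to a uniformly random
neighbour, with replacement, all calls being independent. -/
noncomputable def roundLaw {V : Type*} [Fintype V] [MeasurableSpace V] (G : SimpleGraph V)
    (k : ℕ) : Measure (V → Fin k → V) :=
  Measure.pi fun v => Measure.pi fun _ : Fin k =>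
    (PMF.uniformOfFinset (callees G v) (callees_nonempty G v)).toMeasure

instance roundLaw_isProbabilityMeasure {V : Type*} [Fintype V] [MeasurableSpace V]
    (G : SimpleGraph V) (k : ℕ) : IsProbabilityMeasure (roundLaw G k) := by
  unfold roundLaw
  infer_instance

/-- The law of all calls of the `k`-PUSH&PULL protocol on `G`: the rounds are independent. -/
noncomputable def callLaw {V : Type*} [Fintype V] [MeasurableSpace V] (G : SimpleGraph V)
    (k : ℕ) : Measure (Calls V k) :=
  Measure.infinitePi fun _ : ℕ => roundLaw G k

/-- One round of PUSH&PULL from the set `I` of informed nodes, with calls `c`: the informed nodes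
stay informed, every informed node informs the nodes it calls (PUSH), and a node is informed if
one of the nodes it calls is informed (PULL). -/
def pushPullStep {V : Type*} {k : ℕ} (c : V → Fin k → V) (I : Set V) : Set V :=
  I ∪ {v | ∃ u ∈ I, ∃ i, c u i = v} ∪ {v | ∃ i, c v i ∈ I}

/-- The set of informed nodes after `t` rounds, when initially only `s` knows the rumor. -/
def informed {V : Type*} {k : ℕ} (s : V) (ω : Calls V k) : ℕ → Set V
  | 0 => {s}
  | t + 1 => pushPullStep (ω t) (informed s ω t)

/-- The number of rounds until all nodes are informed (`⊤` if this never happens). -/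
noncomputable def spreadingTime {V : Type*} {k : ℕ} (s : V) (ω : Calls V k) : ℕ∞ :=
  ⨅ (t : ℕ) (_ : informed s ω t = Set.univ), (t : ℕ∞)

/-!
One graph, chosen from `n` and `φ` alone, meets both lower bounds: the union of `⌈28 φ⌉`
suitable permutations of the nodes, whose degrees lie within a constant factor of `φ`, or the
complete graph if `n < 1 + 1.6 φ`, when no set is required to expand.

*Expansion.* Such permutations exist by counting. A random permutation maps `S` into `T` with
probability at most `(|T| / n) ^ |S|` (`card_perm_mapsTo_le`). A non-expanding `S` of size `s` is
mapped by all permutations into one set of size `t < (1 + φ) s ≤ (10 / 13) n`; thanks to the gap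
between `1 + φ` and `1 + 1.6 φ`, the factor `(t / n) ^ (28 φ s)` beats the number of choices of `S`
and `T` (`choose_mul_choose_mul_pow_le`). Expansion of singletons gives all degrees at least `φ`, so
that `∑ 1 / deg v` over the neighbours `v` of any node is bounded (`exists_isVertexExpander`).

*The bound `log_φ n`.* Almost surely all calls go along edges, so the informed set grows by a factor
of at most `1 + 58 φ` per round, a fixed power of `φ` since `φ ≥ φ₀ > 1`
(`callLaw_informed_eq_univ_eq_zero`).

*The bound `log_k n`.* In one round from the informed set `I`, at most `k |I|` nodes are informed by
pushes, and the expected number of pulls is `O(k |I|)`. The pulls of different nodes are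
independent, so `E exp (l |I_{t+1}|) ≤ E exp (l a |I_t|)` for `0 ≤ l ≤ 1`, with `a = O(k)`.
Iterating from `l = a ^ (-t)` and applying Markov's inequality gives
`P (I_t = V) ≤ exp (1 - n / a ^ t)` (`callLaw_informed_eq_univ_le`), which for `a ^ t ≤ √n` is
eventually below any power of `n`.

The larger of the two logarithms is at least half of their sum, so the theorem follows with the
first bound if `φ ≤ k` and with the second otherwise. The finitely many `n` for which
`exp (1 - √n) > n ^ (-γ)` are covered by making the constant so small that the claimed time is below
one round.
-/

/-! ### The informed set and the law of the calls -/

theorem informed_congr {V : Type*} {k : ℕ} (s : V) {ω ω' : Calls V k} {t : ℕ}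
    (h : ∀ i < t, ω i = ω' i) : informed s ω t = informed s ω' t := by
  induction t with
  | zero => rfl
  | succ t ih =>
    simp only [informed]
    rw [h t (Nat.lt_succ_self t), ih fun i hi => h i (Nat.lt_succ_of_lt hi)]

theorem informed_mono {V : Type*} {k : ℕ} (s : V) (ω : Calls V k) : Monotone (informed s ω) :=
  monotone_nat_of_le_succ fun _ _ hv => Or.inl (Or.inl hv)

/-- The informed set at time `t` is a function of the calls of the first `t` rounds, which take
values in a finite set when the graph is finite. -/
theorem exists_informed_eq (V : Type*) (k : ℕ) (s : V) (t : ℕ) :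
    ∃ g : (Finset.range t → V → Fin k → V) → Set V,
      ∀ ω : Calls V k, informed s ω t = g fun i => ω i := by
  classical
  refine ⟨fun J => informed s
    (fun i => if h : i ∈ Finset.range t then J ⟨i, h⟩ else fun v _ => v) t,
    fun ω => informed_congr s fun i hi => by simp [hi]⟩

section Law

instance callLaw_isProbabilityMeasure {V : Type*} [Fintype V] [MeasurableSpace V]
    (G : SimpleGraph V) (k : ℕ) : IsProbabilityMeasure (callLaw G k) := by
  unfold callLaw
  infer_instance

variable {V : Type*} [Fintype V] [MeasurableSpace V] [DiscreteMeasurableSpace V]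

theorem measurable_comp_informed {β : Type*} [MeasurableSpace β] {k : ℕ} (s : V) (t : ℕ)
    (f : Set V → β) : Measurable fun ω : Calls V k => f (informed s ω t) := by
  obtain ⟨g, hg⟩ := exists_informed_eq V k s t
  simp only [hg]
  exact (Measurable.of_discrete (f := fun J => f (g J))).comp (by fun_prop)

/-- The calls of round `t` are independent of the set of nodes informed before it. -/
theorem lintegral_round_informed (G : SimpleGraph V) (k : ℕ) (s : V) (t : ℕ)
    (F : (V → Fin k → V) → Set V → ℝ≥0∞) :
    ∫⁻ ω, F (ω t) (informed s ω t) ∂callLaw G k =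
      ∫⁻ ω, ∫⁻ c, F c (informed s ω t) ∂roundLaw G k ∂callLaw G k := by
  classical
  obtain ⟨g, hg⟩ := exists_informed_eq V k s t
  have hind : ProbabilityTheory.IndepFun (fun (ω : Calls V k) (i : Finset.range t) => ω i)
      (fun ω => ω t) (callLaw G k) := by
    have h := (ProbabilityTheory.iIndepFun_infinitePi (P := fun _ : ℕ => roundLaw G k)
      (X := fun _ c => c) (fun _ => measurable_id)).indepFun_finset (Finset.range t) {t}
      (by simp) (fun i => measurable_pi_apply i)
    exact h.comp measurable_id (measurable_pi_apply (⟨t, by simp⟩ : ({t} : Finset ℕ)))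
  have hm1 : Measurable fun (ω : Calls V k) (i : Finset.range t) => ω i := by fun_prop
  have hm2 : Measurable fun ω : Calls V k => ω t := by fun_prop
  have hmap := hind.map_prod_eq_prod_map_map hm1.aemeasurable hm2.aemeasurable
  have hev : (callLaw G k).map (fun ω => ω t) = roundLaw G k :=
    (measurePreserving_eval_infinitePi (fun _ : ℕ => roundLaw G k) t).map_eq
  rw [hev] at hmap
  have hF : Measurable fun p : (Finset.range t → V → Fin k → V) × (V → Fin k → V) =>
      F p.2 (g p.1) := by
    have : DiscreteMeasurableSpace ((Finset.range t → V → Fin k → V) × (V → Fin k → V)) :=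
      MeasurableSingletonClass.toDiscreteMeasurableSpace
    exact .of_discrete
  calc ∫⁻ ω, F (ω t) (informed s ω t) ∂callLaw G k
      = ∫⁻ ω, (fun p : (Finset.range t → V → Fin k → V) × (V → Fin k → V) =>
          F p.2 (g p.1)) (fun i => ω i, ω t) ∂callLaw G k := by
        simp only [hg]
    _ = _ := by
        rw [← lintegral_map hF (hm1.prodMk hm2), hmap, lintegral_prod _ hF.aemeasurable,
          lintegral_map .of_discrete hm1]
        simp only [hg]

end Law

/-! ### Exponential moments of the number of informed nodes -/

section Step

variable {V : Type*} [Fintype V]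

/-- Pushes are counted with their worst-case number `k * |I|`; only the pulls remain random. -/
theorem ncard_pushPullStep_le {k : ℕ} (c : V → Fin k → V) (I : Set V) :
    (pushPullStep c I).ncard ≤ I.ncard + k * I.ncard + {v | v ∉ I ∧ ∃ i, c v i ∈ I}.ncard := by
  have h : pushPullStep c I ⊆
      (I ∪ (fun p : V × Fin k => c p.1 p.2) '' (I ×ˢ Set.univ)) ∪ {v | v ∉ I ∧ ∃ i, c v i ∈ I} := by
    rintro v ((hv | ⟨u, hu, i, rfl⟩) | hv)
    · exact Or.inl (Or.inl hv)
    · exact Or.inl (Or.inr ⟨(u, i), ⟨hu, trivial⟩, rfl⟩)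
    · by_cases hvI : v ∈ I
      · exact Or.inl (Or.inl hvI)
      · exact Or.inr ⟨hvI, hv⟩
  refine (Set.ncard_le_ncard h).trans ((Set.ncard_union_le _ _).trans ?_)
  gcongr
  refine (Set.ncard_union_le _ _).trans ?_
  gcongr
  refine (Set.ncard_image_le).trans ?_
  rw [Set.ncard_prod, Set.ncard_univ, Nat.card_fin, mul_comm]

variable [MeasurableSpace V] [DiscreteMeasurableSpace V]

open Classical in
/-- The probability that a given call of the uninformed node `v` reaches `I`. For an isolated `v`
both sides vanish, because its only option is `v ∉ I`. -/
theorem call_mem_le (G : SimpleGraph V) {I : Set V} {v : V} (hv : v ∉ I) :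
    (PMF.uniformOfFinset (callees G v) (callees_nonempty G v)).toMeasure I ≤
      ENNReal.ofReal (∑ u with u ∈ I ∧ G.Adj u v, (G.degree v : ℝ)⁻¹) := by
  rw [PMF.toMeasure_uniformOfFinset_apply _ _ .of_discrete]
  unfold callees
  split_ifs with h
  · have hd : Finset.univ.filter (fun w => G.Adj v w) = G.neighborFinset v := by ext; simp
    have hpos : 0 < G.degree v := (G.degree_pos_iff_exists_adj v).2 h
    rw [Finset.sum_const, nsmul_eq_mul, ← div_eq_mul_inv, ENNReal.ofReal_div_of_pos (by simpa),
      ENNReal.ofReal_natCast, ENNReal.ofReal_natCast, hd, G.card_neighborFinset_eq_degree]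
    gcongr
    intro u
    simp only [Finset.mem_filter, SimpleGraph.mem_neighborFinset, Finset.mem_univ, true_and]
    exact fun hu => ⟨hu.2, hu.1.symm⟩
  · rw [Finset.filter_singleton, if_neg hv]
    simp

/-- `E exp (l 1_A) = 1 + (exp l - 1) P(A) ≤ exp (2 l p)`, as `exp l - 1 ≤ 2 l` for `l ≤ 1`. -/
theorem lintegral_exp_indicator_le {Ω : Type*} [MeasurableSpace Ω] (μ : Measure Ω)
    [IsProbabilityMeasure μ] {A : Set Ω} [DecidablePred (· ∈ A)]
    (hA : MeasurableSet A) {l p : ℝ} (hl : 0 ≤ l)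
    (hl1 : l ≤ 1) (hp : μ A ≤ ENNReal.ofReal p) (hp0 : 0 ≤ p) :
    ∫⁻ x, ENNReal.ofReal (Real.exp (l * if x ∈ A then 1 else 0)) ∂μ ≤
      ENNReal.ofReal (Real.exp (2 * l * p)) := by
  have he : Real.exp l - 1 ≤ 2 * l := by
    have := Real.abs_exp_sub_one_le (x := l) (by rwa [abs_of_nonneg hl])
    rw [abs_of_nonneg hl] at this
    exact (le_abs_self _).trans this
  have h1 : 1 ≤ Real.exp l := Real.one_le_exp hl
  calc ∫⁻ x, ENNReal.ofReal (Real.exp (l * if x ∈ A then 1 else 0)) ∂μ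
      = ∫⁻ x, (1 + A.indicator (fun _ => ENNReal.ofReal (Real.exp l - 1)) x) ∂μ := by
        refine lintegral_congr fun x => ?_
        by_cases hx : x ∈ A
        · rw [Set.indicator_of_mem hx, if_pos hx, ← ENNReal.ofReal_one,
            ← ENNReal.ofReal_add zero_le_one (by linarith)]
          simp
        · simp [hx]
    _ = 1 + ENNReal.ofReal (Real.exp l - 1) * μ A := by
        rw [lintegral_add_left measurable_const, lintegral_indicator_const hA]
        simp
    _ ≤ ENNReal.ofReal 1 + ENNReal.ofReal (2 * l) * ENNReal.ofReal p := by
        rw [ENNReal.ofReal_one]; gcongr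
    _ = ENNReal.ofReal (2 * l * p + 1) := by
        rw [← ENNReal.ofReal_mul (by positivity),
          ← ENNReal.ofReal_add zero_le_one (by positivity), add_comm]
    _ ≤ _ := ENNReal.ofReal_le_ofReal (Real.add_one_le_exp _)

open Classical in
/-- One round from a fixed informed set `I`. The hypothesis says that the expected number of nodes
reaching `u` by their first call is at most `K`, so the expected number of pulls from `I` is at most
`k * K * |I|`; the pulls of different nodes are independent, and the exponential moment
factorizes. -/
theorem lintegral_exp_pushPullStep_le (G : SimpleGraph V) (k : ℕ) {K : ℝ}
    (hK : ∀ u, ∑ v with G.Adj u v, (G.degree v : ℝ)⁻¹ ≤ K) {l : ℝ} (hl : 0 ≤ l) (hl1 : l ≤ 1)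
    (I : Set V) :
    ∫⁻ c, ENNReal.ofReal (Real.exp (l * (pushPullStep c I).ncard)) ∂roundLaw G k ≤
      ENNReal.ofReal (Real.exp (l * (1 + (1 + 2 * K) * k) * I.ncard)) := by
  -- `A v` is the event that `v` learns the rumor by a pull, and `p v` bounds its probability.
  let A : V → Set (Fin k → V) := fun v => {x | v ∉ I ∧ ∃ i, x i ∈ I}
  let p : V → ℝ := fun v => k * ∑ u with u ∈ I ∧ G.Adj u v, (G.degree v : ℝ)⁻¹
  have hp0 (v : V) : 0 ≤ p v := by positivity
  have hA (v : V) : Measure.pi (fun _ : Fin k =>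
      (PMF.uniformOfFinset (callees G v) (callees_nonempty G v)).toMeasure) (A v) ≤
        ENNReal.ofReal (p v) := by
    by_cases hv : v ∈ I
    · simp [A, hv]
    have hsub : A v ⊆ ⋃ i : Fin k, Function.eval i ⁻¹' I := fun x hx => Set.mem_iUnion.2 hx.2
    refine (measure_mono hsub).trans ((measure_iUnion_le _).trans ?_)
    rw [tsum_fintype]
    have heval (i : Fin k) := (measurePreserving_eval (fun _ : Fin k =>
      (PMF.uniformOfFinset (callees G v) (callees_nonempty G v)).toMeasure) i).measure_preimage
        (s := I) (MeasurableSet.of_discrete.nullMeasurableSet)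
    simp only [heval, Finset.sum_const, Finset.card_univ, Fintype.card_fin, nsmul_eq_mul]
    rw [ENNReal.ofReal_mul (by positivity), ENNReal.ofReal_natCast]
    gcongr
    exact call_mem_le G hv
  have hsum : ∑ v, p v ≤ k * (K * I.ncard) := by
    simp only [p, ← Finset.mul_sum]
    gcongr
    calc ∑ v, ∑ u with u ∈ I ∧ G.Adj u v, (G.degree v : ℝ)⁻¹
        = ∑ u with u ∈ I, ∑ v with G.Adj u v, (G.degree v : ℝ)⁻¹ :=
          Finset.sum_comm' (by simp [and_comm])
      _ ≤ ∑ u with u ∈ I, K := Finset.sum_le_sum fun u _ => hK u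
      _ = K * I.ncard := by
          rw [Finset.sum_const, nsmul_eq_mul, mul_comm, Set.ncard_eq_toFinset_card']
          congr 3
          ext; simp
  have hcard (c : V → Fin k → V) : ((pushPullStep c I).ncard : ℝ) ≤
      (1 + k) * I.ncard + ∑ v, if c v ∈ A v then (1 : ℝ) else 0 := by
    have h := ncard_pushPullStep_le c I
    have h' : ({v | v ∉ I ∧ ∃ i, c v i ∈ I}.ncard : ℝ) = ∑ v, if c v ∈ A v then (1 : ℝ) else 0 := by
      rw [Finset.sum_boole, Set.ncard_eq_toFinset_card']
      congr 2
      ext; simp [A]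
    rw [← h']
    have h2 : ((pushPullStep c I).ncard : ℝ) ≤ I.ncard + k * I.ncard +
      {v | v ∉ I ∧ ∃ i, c v i ∈ I}.ncard := by exact_mod_cast h
    linarith
  have hfac : ∫⁻ c : V → Fin k → V,
      ∏ v, ENNReal.ofReal (Real.exp (l * if c v ∈ A v then 1 else 0)) ∂roundLaw G k =
        ∏ v, ∫⁻ c : V → Fin k → V,
          ENNReal.ofReal (Real.exp (l * if c v ∈ A v then 1 else 0)) ∂roundLaw G k :=
    ProbabilityTheory.lintegral_prod_eq_prod_lintegral_of_indepFun Finset.univ _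
      (ProbabilityTheory.iIndepFun_pi (X := fun v (x : Fin k → V) =>
        ENNReal.ofReal (Real.exp (l * if x ∈ A v then 1 else 0)))
        fun v => Measurable.of_discrete.aemeasurable) fun v => .of_discrete
  calc ∫⁻ c, ENNReal.ofReal (Real.exp (l * (pushPullStep c I).ncard)) ∂roundLaw G k
      ≤ ∫⁻ c, ENNReal.ofReal (Real.exp (l * ((1 + k) * I.ncard))) *
          ∏ v, ENNReal.ofReal (Real.exp (l * if c v ∈ A v then 1 else 0)) ∂roundLaw G k := by
        refine lintegral_mono fun c => ?_
        rw [← ENNReal.ofReal_prod_of_nonneg fun _ _ => (Real.exp_pos _).le, ← Real.exp_sum,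
          ← ENNReal.ofReal_mul (Real.exp_pos _).le, ← Real.exp_add, ← Finset.mul_sum, ← mul_add]
        have := hcard c
        gcongr
    _ ≤ ENNReal.ofReal (Real.exp (l * ((1 + k) * I.ncard))) *
          ∏ v, ENNReal.ofReal (Real.exp (2 * l * p v)) := by
        rw [lintegral_const_mul _ .of_discrete, hfac]
        gcongr with v
        have hmp := measurePreserving_eval (fun v => Measure.pi fun _ : Fin k =>
          (PMF.uniformOfFinset (callees G v) (callees_nonempty G v)).toMeasure) v
        have hcomp := hmp.lintegral_comp (f := fun x =>
          ENNReal.ofReal (Real.exp (l * if x ∈ A v then 1 else 0))) .of_discrete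
        refine hcomp.le.trans ?_
        exact lintegral_exp_indicator_le _ .of_discrete hl hl1 (hA v) (hp0 v)
    _ ≤ _ := by
        rw [← ENNReal.ofReal_prod_of_nonneg fun _ _ => (Real.exp_pos _).le, ← Real.exp_sum,
          ← ENNReal.ofReal_mul (Real.exp_pos _).le, ← Real.exp_add, ← Finset.mul_sum]
        refine ENNReal.ofReal_le_ofReal (Real.exp_le_exp.2 ?_)
        nlinarith [mul_le_mul_of_nonneg_left hsum hl]

open Classical in
/-- Each round costs a factor `1 + (1 + 2 * K) * k` in the exponent. The bound on `l` ensures that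
the exponents met on the way stay at most `1`, as the one-round estimate requires. -/
theorem lintegral_exp_informed_le (G : SimpleGraph V) (k : ℕ) {K : ℝ} (hK0 : 0 ≤ K)
    (hK : ∀ u, ∑ v with G.Adj u v, (G.degree v : ℝ)⁻¹ ≤ K) (s : V) (t : ℕ) :
    ∀ l : ℝ, 0 ≤ l → l * (1 + (1 + 2 * K) * k) ^ t ≤ 1 →
      ∫⁻ ω, ENNReal.ofReal (Real.exp (l * (informed s ω t).ncard)) ∂callLaw G k ≤
        ENNReal.ofReal (Real.exp (l * (1 + (1 + 2 * K) * k) ^ t)) := by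
  have ha : (1 : ℝ) ≤ 1 + (1 + 2 * K) * k := le_add_of_nonneg_right (by positivity)
  induction t with
  | zero => intro l _ _; simp [informed]
  | succ t ih =>
    intro l hl hlt
    have hl1 : l ≤ 1 := by
      have := mul_le_mul_of_nonneg_left (one_le_pow₀ ha (n := t + 1)) hl
      linarith
    have h := lintegral_round_informed G k s t
      fun c I => ENNReal.ofReal (Real.exp (l * (pushPullStep c I).ncard))
    simp only [informed]
    rw [h]
    refine (lintegral_mono fun ω => lintegral_exp_pushPullStep_le G k hK hl hl1 _).trans ?_
    have := ih (l * (1 + (1 + 2 * K) * k)) (by positivity) (by rwa [mul_assoc, ← pow_succ'])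
    rwa [mul_assoc l _ (_ ^ t), ← pow_succ'] at this

open Classical in
/-- Markov's inequality for `exp (|I_t| / a)` with `a = (1 + (1 + 2 * K) * k) ^ t`, the smallest
divisor for which the bound on the exponential moment is available. -/
theorem callLaw_informed_eq_univ_le (G : SimpleGraph V) (k : ℕ) {K : ℝ} (hK0 : 0 ≤ K)
    (hK : ∀ u, ∑ v with G.Adj u v, (G.degree v : ℝ)⁻¹ ≤ K) (s : V) (t : ℕ) :
    (callLaw G k).real {ω | informed s ω t = Set.univ} ≤
      Real.exp (1 - Fintype.card V / (1 + (1 + 2 * K) * k) ^ t) := by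
  set a : ℝ := (1 + (1 + 2 * K) * k) ^ t
  have ha : 0 < a := by positivity
  have h := lintegral_exp_informed_le G k hK0 hK s t a⁻¹ (by positivity) (by
    rw [inv_mul_cancel₀ ha.ne'])
  rw [inv_mul_cancel₀ ha.ne'] at h
  refine ENNReal.toReal_le_of_le_ofReal (Real.exp_pos _).le ?_
  have hn0 : ENNReal.ofReal (Real.exp (Fintype.card V / a)) ≠ 0 := by
    simp [Real.exp_pos]
  rw [Real.exp_sub, ENNReal.ofReal_div_of_pos (Real.exp_pos _),
    ENNReal.le_div_iff_mul_le (Or.inl hn0) (Or.inl ENNReal.ofReal_ne_top), mul_comm]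
  have hmeas : Measurable fun ω : Calls V k =>
      ENNReal.ofReal (Real.exp (a⁻¹ * (informed s ω t).ncard)) :=
    measurable_comp_informed s t fun I => ENNReal.ofReal (Real.exp (a⁻¹ * I.ncard))
  refine le_trans ?_ ((mul_meas_ge_le_lintegral hmeas
    (ENNReal.ofReal (Real.exp (Fintype.card V / a)))).trans h)
  refine mul_le_mul_right (measure_mono fun ω hω => ?_) _
  simp only [Set.mem_ofPred_eq] at hω ⊢
  rw [hω, Set.ncard_univ, Nat.card_eq_fintype_card, div_eq_inv_mul]

end Step

/-! ### Random permutations -/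

/-- A uniformly random permutation maps `S` into `T` with probability at most
`(|T| / |V|) ^ |S|`. -/
theorem card_perm_mapsTo_le {V : Type*} [Fintype V] [DecidableEq V] (S T : Finset V) :
    Fintype.card V ^ S.card * (Finset.univ.filter
      fun π : Equiv.Perm V => ∀ a ∈ S, π a ∈ T).card ≤
        T.card ^ S.card * (Fintype.card V).factorial := by
  induction S using Finset.induction_on with
  | empty => simp [Fintype.card_perm]
  | insert a S ha ih =>
    set A := Finset.univ.filter fun π : Equiv.Perm V => ∀ x ∈ S, π x ∈ T with hA
    set A' := Finset.univ.filter fun π : Equiv.Perm V => ∀ x ∈ insert a S, π x ∈ T with hA'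
    -- Exchanging the images of `a` and `c` shows that, for `c ∉ S`, the image of `c` lies in `T` as
    -- often as that of `a`; for `c ∈ S` it always does.
    have hc (c : V) : A'.card ≤ (A.filter fun π => π c ∈ T).card := by
      by_cases hcS : c ∈ S
      · refine Finset.card_le_card fun π hπ => ?_
        simp only [hA, hA', Finset.mem_filter, Finset.mem_univ, true_and, Finset.mem_insert] at hπ ⊢
        exact ⟨fun x hx => hπ x (Or.inr hx), hπ c (Or.inr hcS)⟩
      · refine Finset.card_le_card_of_injOn (fun π => π * Equiv.swap a c) (fun π hπ => ?_)
          fun π _ σ _ h => mul_right_cancel h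
        simp only [hA, hA', Finset.coe_filter, Set.mem_ofPred_eq, Finset.mem_filter,
          Finset.mem_univ, true_and, Finset.mem_insert] at hπ ⊢
        refine ⟨fun x hx => ?_, ?_⟩
        · rw [Equiv.Perm.mul_apply, Equiv.swap_apply_of_ne_of_ne (ne_of_mem_of_not_mem hx ha)
            (ne_of_mem_of_not_mem hx hcS)]
          exact hπ x (Or.inr hx)
        · simpa using hπ a (Or.inl rfl)
    have hcount : Fintype.card V * A'.card ≤ T.card * A.card := by
      calc Fintype.card V * A'.card = ∑ _c : V, A'.card := by simp
        _ ≤ ∑ c, (A.filter fun π => π c ∈ T).card := Finset.sum_le_sum fun c _ => hc c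
        _ = ∑ π ∈ A, (Finset.univ.filter fun c => π c ∈ T).card := by
            simp only [Finset.card_filter]
            exact Finset.sum_comm
        _ = ∑ π ∈ A, T.card := Finset.sum_congr rfl fun π _ =>
            Finset.card_bijective π π.bijective (by simp)
        _ = T.card * A.card := by rw [Finset.sum_const, smul_eq_mul, mul_comm]
    rw [Finset.card_insert_of_notMem ha]
    calc Fintype.card V ^ (S.card + 1) * A'.card
        = Fintype.card V ^ S.card * (Fintype.card V * A'.card) := by ring
      _ ≤ Fintype.card V ^ S.card * (T.card * A.card) := by gcongr
      _ = T.card * (Fintype.card V ^ S.card * A.card) := by ring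
      _ ≤ T.card * (T.card ^ S.card * (Fintype.card V).factorial) := by gcongr
      _ = _ := by ring

/-- The union bound over all `S` and `T`: some `d` permutations do not simultaneously map any `S`
with `|S| ∈ R` into a set of only `t |S|` elements. -/
theorem exists_perms_of_sum_lt_one {V : Type*} [Fintype V] [DecidableEq V] (d : ℕ) (R : Finset ℕ)
    (t : ℕ → ℕ)
    (h : ∑ s ∈ R, ((Fintype.card V).choose s * (Fintype.card V).choose (t s) : ℝ) *
      ((t s : ℝ) / Fintype.card V) ^ (s * d) < 1) :
    ∃ π : Fin d → Equiv.Perm V, ∀ S T : Finset V, S.card ∈ R → T.card = t S.card →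
      ∃ i, ∃ a ∈ S, π i a ∉ T := by
  by_contra! hcon
  set n := Fintype.card V with hn
  let A : Finset V → Finset V → Finset (Equiv.Perm V) := fun S T =>
    Finset.univ.filter fun π : Equiv.Perm V => ∀ a ∈ S, π a ∈ T
  have hcover : (Finset.univ : Finset (Fin d → Equiv.Perm V)) ⊆
      R.biUnion fun s => (Finset.powersetCard s Finset.univ).biUnion fun S =>
        (Finset.powersetCard (t s) Finset.univ).biUnion fun T =>
          Fintype.piFinset fun _ => A S T := by
    intro π _
    obtain ⟨S, T, hS, hT, hST⟩ := hcon π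
    simp only [Finset.mem_biUnion, Finset.mem_powersetCard_univ, Fintype.mem_piFinset]
    exact ⟨S.card, hS, S, rfl, T, hT, fun i => by simpa [A] using hST i⟩
  have hf : (0 : ℝ) < (n.factorial : ℝ) ^ d := by positivity
  have hA (S T : Finset V) : ((A S T).card : ℝ) ≤ ((T.card : ℝ) / n) ^ S.card * n.factorial := by
    rcases Nat.eq_zero_or_pos n with h0 | hpos
    · have : IsEmpty V := Fintype.card_eq_zero_iff.1 h0
      have hS0 : S.card = 0 := by simp [Finset.eq_empty_of_isEmpty S]
      have h2 : (A S T).card ≤ Fintype.card (Equiv.Perm V) := Finset.card_le_univ _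
      rw [Fintype.card_perm] at h2
      rw [hS0, pow_zero, one_mul]
      exact_mod_cast h2
    · have h1 := card_perm_mapsTo_le S T
      have h2 : (n : ℝ) ^ S.card * (A S T).card ≤ (T.card : ℝ) ^ S.card * n.factorial := by
        exact_mod_cast h1
      rw [div_pow, div_mul_eq_mul_div, le_div_iff₀ (by positivity), mul_comm]
      exact h2
  have hcard := (Finset.card_le_card hcover).trans Finset.card_biUnion_le
  have : (n.factorial : ℝ) ^ d ≤ ∑ s ∈ R, ((n.choose s * n.choose (t s) : ℝ) *
      ((t s : ℝ) / n) ^ (s * d)) * (n.factorial : ℝ) ^ d := by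
    calc (n.factorial : ℝ) ^ d = (Finset.univ : Finset (Fin d → Equiv.Perm V)).card := by
          simp [Fintype.card_perm, hn]
      _ ≤ ∑ s ∈ R, (((Finset.powersetCard s Finset.univ).biUnion fun S =>
        (Finset.powersetCard (t s) Finset.univ).biUnion fun T =>
          Fintype.piFinset fun _ : Fin d => A S T).card : ℝ) := by exact_mod_cast hcard
      _ ≤ _ := by
        refine Finset.sum_le_sum fun s _ => ?_
        calc _ ≤ ∑ S ∈ Finset.powersetCard s (Finset.univ : Finset V),
              ∑ T ∈ Finset.powersetCard (t s) (Finset.univ : Finset V),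
                ((Fintype.piFinset fun _ : Fin d => A S T).card : ℝ) := by
              exact_mod_cast Finset.card_biUnion_le.trans
                (Finset.sum_le_sum fun S _ => Finset.card_biUnion_le)
          _ ≤ ∑ S ∈ Finset.powersetCard s (Finset.univ : Finset V),
              ∑ T ∈ Finset.powersetCard (t s) (Finset.univ : Finset V),
                (((t s : ℝ) / n) ^ (s * d) * (n.factorial : ℝ) ^ d) := by
              refine Finset.sum_le_sum fun S hS => Finset.sum_le_sum fun T hT => ?_
              rw [Finset.mem_powersetCard_univ] at hS hT
              have := hA S T
              rw [hS, hT] at this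
              rw [Fintype.card_piFinset_const, Nat.cast_pow, pow_mul, ← mul_pow]
              gcongr
          _ = _ := by
              simp only [Finset.sum_const, Finset.card_powersetCard, Finset.card_univ, nsmul_eq_mul]
              ring
  rw [← Finset.sum_mul] at this
  nlinarith

theorem choose_mul_pow_le (n t r : ℕ) (hn : n ≠ 0) :
    (n.choose r : ℝ) * ((t : ℝ) / n) ^ r ≤ (t : ℝ) ^ r / r.factorial := by
  have h := Nat.choose_le_pow_div (α := ℝ) r n
  calc (n.choose r : ℝ) * ((t : ℝ) / n) ^ r ≤ (n : ℝ) ^ r / r.factorial * ((t : ℝ) / n) ^ r := by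
        gcongr
    _ = _ := by
        have : (n : ℝ) ≠ 0 := by exact_mod_cast hn
        rw [div_mul_eq_mul_div, ← mul_pow, mul_div_cancel₀ _ this]

/-- The numerical heart of the union bound. Of the `s * d` factors `t / n`, `s + t` are used up to
turn the binomial coefficients into `exp (O (φ s))`; the others are at most
`10 / 13 < exp (-1 / 5)`, since `(1 + φ) / (1 + 1.6 φ) ≤ 2 / 2.6`, and there are enough of them to
win. -/
theorem choose_mul_choose_mul_pow_le {n s t d : ℕ} {φ : ℝ} (hφ : 1 ≤ φ) (hs : 1 ≤ s)
    (hsn : (1 + 1.6 * φ) * s ≤ n) (ht : (t : ℝ) ≤ (1 + φ) * s) (hd : 28 * φ ≤ d) :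
    (n.choose s * n.choose t : ℝ) * ((t : ℝ) / n) ^ (s * d) ≤ Real.exp (-s) := by
  have hs1 : (1 : ℝ) ≤ s := by exact_mod_cast hs
  have hs0 : (0 : ℝ) < s := by linarith
  have hn0 : (0 : ℝ) < n := lt_of_lt_of_le (by positivity) hsn
  have hn : n ≠ 0 := by exact_mod_cast hn0.ne'
  set x : ℝ := (t : ℝ) / n with hx
  have hx0 : 0 ≤ x := by positivity
  have hx1 : x ≤ Real.exp (-(1 / 5)) := by
    have h1 : x ≤ 4 / 5 := by
      rw [hx, div_le_iff₀ hn0]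
      nlinarith
    have := Real.add_one_le_exp (-(1 / 5) : ℝ)
    linarith
  have hle : s + t ≤ s * d := by
    have : (s + t : ℝ) ≤ s * d := by nlinarith
    exact_mod_cast this
  have hC1 : (n.choose s : ℝ) * x ^ s ≤ Real.exp ((1 + φ) * s) := by
    calc (n.choose s : ℝ) * x ^ s ≤ (t : ℝ) ^ s / s.factorial := choose_mul_pow_le n t s hn
      _ ≤ ((1 + φ) * s) ^ s / s.factorial := by gcongr
      _ ≤ Real.exp ((1 + φ) * s) := Real.pow_div_factorial_le_exp _ (by positivity) s
  have hC2 : (n.choose t : ℝ) * x ^ t ≤ Real.exp ((1 + φ) * s) := by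
    calc (n.choose t : ℝ) * x ^ t ≤ (t : ℝ) ^ t / t.factorial := choose_mul_pow_le n t t hn
      _ ≤ Real.exp t := Real.pow_div_factorial_le_exp _ (by positivity) t
      _ ≤ _ := Real.exp_le_exp.2 ht
  have hC3 : x ^ (s * d - (s + t)) ≤ Real.exp (-(5 * φ * s)) := by
    calc x ^ (s * d - (s + t)) ≤ Real.exp (-(1 / 5)) ^ (s * d - (s + t)) := by gcongr
      _ = Real.exp (-((s * d - (s + t)) / 5)) := by
          rw [← Real.exp_nat_mul, Nat.cast_sub hle]
          push_cast
          ring_nf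
      _ ≤ _ := by
          refine Real.exp_le_exp.2 ?_
          nlinarith
  calc (n.choose s * n.choose t : ℝ) * x ^ (s * d)
      = (n.choose s * x ^ s) * (n.choose t * x ^ t) * x ^ (s * d - (s + t)) := by
        rw [show x ^ (s * d) = x ^ s * x ^ t * x ^ (s * d - (s + t)) by
          rw [← pow_add, ← pow_add, Nat.add_sub_cancel' hle]]
        ring
    _ ≤ Real.exp ((1 + φ) * s) * Real.exp ((1 + φ) * s) * Real.exp (-(5 * φ * s)) := by gcongr
    _ ≤ Real.exp (-s) := by
        rw [← Real.exp_add, ← Real.exp_add]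
        refine Real.exp_le_exp.2 ?_
        nlinarith

theorem sum_exp_neg_lt_one (n : ℕ) : ∑ s ∈ Finset.Icc 1 n, Real.exp (-s) < 1 := by
  have h2 : Real.exp (-1) ≤ 1 / 2 := by
    rw [Real.exp_neg, ← one_div]
    exact one_div_le_one_div_of_le two_pos (by linarith [Real.add_one_le_exp (1 : ℝ)])
  have h (m : ℕ) : ∑ s ∈ Finset.Icc 1 m, Real.exp (-s) ≤ 1 - (1 / 2) ^ m := by
    induction m with
    | zero => simp
    | succ m ih =>
      rw [Finset.sum_Icc_succ_top (by omega)]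
      have : Real.exp (-((m + 1 : ℕ) : ℝ)) ≤ (1 / 2) ^ (m + 1) := by
        rw [show -((m + 1 : ℕ) : ℝ) = (m + 1 : ℕ) * (-1 : ℝ) by ring, Real.exp_nat_mul]
        gcongr
      rw [pow_succ] at this ⊢
      linarith
  have := h n
  have : (0 : ℝ) < (1 / 2) ^ n := by positivity
  linarith

/-! ### Expanders of degree proportional to `φ` -/

/-- The graph in which every `u` is joined to all `π i u` (and hence to all `(π i)⁻¹ u`); loops are
discarded and repeated edges merged. -/
def permGraph {V : Type*} {d : ℕ} (π : Fin d → Equiv.Perm V) : SimpleGraph V :=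
  SimpleGraph.fromRel fun u v => ∃ i, π i u = v

open Classical in
theorem degree_permGraph_le {V : Type*} [Fintype V] {d : ℕ} (π : Fin d → Equiv.Perm V) (v : V) :
    (permGraph π).degree v ≤ 2 * d := by
  have hsub : (permGraph π).neighborFinset v ⊆
      Finset.univ.image (fun i => π i v) ∪ Finset.univ.image (fun i => (π i).symm v) := by
    intro u hu
    rw [SimpleGraph.mem_neighborFinset, permGraph, SimpleGraph.fromRel_adj] at hu
    simp only [Finset.mem_union, Finset.mem_image, Finset.mem_univ, true_and]
    exact hu.2.imp id fun ⟨i, hi⟩ => ⟨i, (Equiv.symm_apply_eq _).2 hi.symm⟩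
  rw [← SimpleGraph.card_neighborFinset_eq_degree, two_mul]
  refine (Finset.card_le_card hsub).trans ((Finset.card_union_le _ _).trans ?_)
  gcongr <;> exact Finset.card_image_le.trans (by simp)

theorem exists_isVertexExpander_permGraph {V : Type*} [Fintype V] {φ : ℝ} (hφ : 1 ≤ φ) {d : ℕ}
    (hd : 28 * φ ≤ d) :
    ∃ π : Fin d → Equiv.Perm V, IsVertexExpander (permGraph π) φ (1 / (1 + 1.6 * φ)) := by
  classical
  set n := Fintype.card V with hn
  -- The largest integer below `(1 + φ) * s`: if `S` does not expand, `S ∪ ∂S` has at most `t |S|`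
  -- elements.
  let t : ℕ → ℕ := fun s => ⌈(1 + φ) * s⌉₊ - 1
  have htlt {s : ℕ} (hs : 1 ≤ s) : (t s : ℝ) < (1 + φ) * s := by
    have : 0 < (1 + φ) * s := by positivity
    refine Nat.lt_ceil.1 ?_
    have := Nat.ceil_pos.2 this
    simp only [t]
    omega
  have hn1 {s : ℕ} (h : (s : ℝ) ≤ 1 / (1 + 1.6 * φ) * n) : (1 + 1.6 * φ) * s ≤ n := by
    rw [one_div_mul_eq_div, le_div_iff₀ (by positivity)] at h
    linarith
  let R := (Finset.Icc 1 n).filter fun s : ℕ => (1 + 1.6 * φ) * s ≤ n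
  obtain ⟨π, hπ⟩ := exists_perms_of_sum_lt_one (V := V) d R t (by
    refine lt_of_le_of_lt ?_ (sum_exp_neg_lt_one n)
    refine (Finset.sum_le_sum fun s hs => ?_).trans (Finset.sum_le_sum_of_subset_of_nonneg
      (Finset.filter_subset _ _) fun s _ _ => (Real.exp_pos _).le)
    obtain ⟨hs1, hs2⟩ := Finset.mem_filter.1 hs
    have hs1 := (Finset.mem_Icc.1 hs1).1
    exact choose_mul_choose_mul_pow_le hφ hs1 hs2 (htlt hs1).le hd)
  refine ⟨π, fun S hS hSn => ?_⟩
  have hS0 : (0 : ℝ) < S.card := by exact_mod_cast hS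
  have hSn' := hn1 hSn
  by_contra! hlt
  rw [div_lt_iff₀ hS0] at hlt
  set N : Finset V := (vertexBoundary (permGraph π) (S : Set V)).toFinset with hN
  rw [Set.ncard_eq_toFinset_card'] at hlt
  have hcard : (S ∪ N).card ≤ t S.card := by
    have h1 : ((S ∪ N).card : ℝ) ≤ S.card + N.card := by
      exact_mod_cast Finset.card_union_le _ _
    have h2 : ((S ∪ N).card : ℝ) < (1 + φ) * S.card := by linarith
    have := Nat.lt_ceil.2 h2
    simp only [t]
    omega
  have htn : t S.card ≤ n := by
    have : (t S.card : ℝ) ≤ n := by nlinarith [htlt hS]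
    exact_mod_cast this
  obtain ⟨T, hT, hTc⟩ := Finset.exists_superset_card_eq hcard htn
  obtain ⟨i, a, ha, hia⟩ := hπ S T (Finset.mem_filter.2
    ⟨Finset.mem_Icc.2 ⟨hS, Finset.card_le_univ S⟩, hSn'⟩) hTc
  refine hia (hT ?_)
  by_cases hmem : π i a ∈ S
  · exact Finset.mem_union_left _ hmem
  · refine Finset.mem_union_right _ ?_
    rw [hN, Set.mem_toFinset]
    refine ⟨by simpa using hmem, a, by simpa using ha, ?_⟩
    rw [permGraph, SimpleGraph.fromRel_adj]
    exact ⟨fun h => hmem (h ▸ ha), Or.inl ⟨i, rfl⟩⟩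

open Classical in
/-- Expanders, for the largest admissible `α`, whose degrees are at most `58 * φ` and which are
regular enough that the pulls from any node number at most `58` per call in expectation. The latter
holds because expansion of singletons forces all degrees to be at least `φ`. If `n` is so small that
singletons are not required to expand, the complete graph serves. -/
theorem exists_isVertexExpander (n : ℕ) {φ : ℝ} (hφ : 1 ≤ φ) :
    ∃ G : SimpleGraph (Fin n), IsVertexExpander G φ (1 / (1 + 1.6 * φ)) ∧
      (∀ v, (G.degree v : ℝ) ≤ 58 * φ) ∧
      ∀ u, ∑ v with G.Adj u v, (G.degree v : ℝ)⁻¹ ≤ 58 := by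
  have hpos : 0 < 1 + 1.6 * φ := by positivity
  have hfilter (G : SimpleGraph (Fin n)) (u : Fin n) :
      (Finset.univ.filter fun v => G.Adj u v).card = G.degree u := by
    rw [← G.card_neighborFinset_eq_degree]
    congr 1
    ext; simp
  rcases lt_or_ge (n : ℝ) (1 + 1.6 * φ) with hn | hn
  · obtain ⟨G, hG⟩ : ∃ G : SimpleGraph (Fin n), G = ⊤ := ⟨⊤, rfl⟩
    have hdeg (v : Fin n) : G.degree v = n - 1 := by
      subst hG
      convert SimpleGraph.complete_graph_degree v
      exact (Fintype.card_fin n).symm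
    refine ⟨G, fun S hS hSn => ?_, fun v => ?_, fun u => ?_⟩
    · have h1 : (1 : ℝ) ≤ S.card := by exact_mod_cast hS
      rw [Fintype.card_fin, one_div_mul_eq_div] at hSn
      have := (div_lt_one hpos).2 hn
      linarith
    · have hv : 1 ≤ n := Fin.pos v
      rw [hdeg, Nat.cast_sub hv]
      push_cast
      linarith
    · simp only [hdeg]
      rw [Finset.sum_const, nsmul_eq_mul, hfilter, hdeg]
      exact mul_inv_le_one.trans (by norm_num)
  · obtain ⟨π, hπ⟩ := exists_isVertexExpander_permGraph (V := Fin n) hφ (Nat.le_ceil (28 * φ))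
    have hdeg (v : Fin n) : ((permGraph π).degree v : ℝ) ≤ 58 * φ := by
      have h1 : ((permGraph π).degree v : ℝ) ≤ 2 * ⌈28 * φ⌉₊ := by
        exact_mod_cast degree_permGraph_le π v
      have h2 := Nat.ceil_lt_add_one (show 0 ≤ 28 * φ by positivity)
      linarith
    have hmin (v : Fin n) : φ ≤ (permGraph π).degree v := by
      have h := hπ {v} (by simp) (by
        rw [Fintype.card_fin, one_div_mul_eq_div, le_div_iff₀ hpos]
        simpa using hn)
      rw [Finset.card_singleton, Nat.cast_one, div_one, Finset.coe_singleton] at h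
      refine h.trans ?_
      rw [← hfilter, ← Set.ncard_coe_finset]
      gcongr
      · exact Finset.finite_toSet _
      · rintro w ⟨_, a, rfl, hw⟩
        simpa using hw
    refine ⟨permGraph π, hπ, hdeg, fun u => ?_⟩
    calc ∑ v with (permGraph π).Adj u v, ((permGraph π).degree v : ℝ)⁻¹
        ≤ ∑ v with (permGraph π).Adj u v, φ⁻¹ := by
          gcongr with v
          exact hmin v
      _ = (permGraph π).degree u * φ⁻¹ := by
          rw [Finset.sum_const, nsmul_eq_mul, hfilter]
      _ ≤ 58 * φ * φ⁻¹ := by gcongr; exact hdeg u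
      _ = 58 := mul_inv_cancel_right₀ (by positivity) _

/-! ### Deterministic growth and the spreading time -/

/-- If the spreading time is below `L`, then everyone is informed at time `⌊L⌋₊`, the last integer
time at which this could have happened. -/
theorem one_sub_le_measure_spreadingTime {V : Type*} [Fintype V] [MeasurableSpace V]
    (G : SimpleGraph V) (k : ℕ) (s : V) (L : ℝ) :
    1 - (callLaw G k).real {ω | informed s ω ⌊L⌋₊ = Set.univ} ≤
      (callLaw G k).real {ω | ENNReal.ofReal L ≤ (spreadingTime s ω : ℝ≥0∞)} := by
  have hcover : {ω : Calls V k | ENNReal.ofReal L ≤ (spreadingTime s ω : ℝ≥0∞)} ∪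
      {ω | informed s ω ⌊L⌋₊ = Set.univ} = Set.univ := by
    refine Set.eq_univ_of_forall fun ω => or_iff_not_imp_right.2 fun hω => ?_
    have hT : ((⌊L⌋₊ + 1 : ℕ) : ℕ∞) ≤ spreadingTime s ω := by
      refine le_iInf₂ fun t ht => ?_
      by_contra! hlt
      have htL : t ≤ ⌊L⌋₊ := Nat.lt_succ_iff.1 (by exact_mod_cast hlt)
      exact hω (Set.univ_subset_iff.1 (ht ▸ informed_mono s ω htL))
    calc ENNReal.ofReal L ≤ ENNReal.ofReal (⌊L⌋₊ + 1 : ℕ) :=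
          ENNReal.ofReal_le_ofReal (by exact_mod_cast (Nat.lt_floor_add_one L).le)
      _ = (((⌊L⌋₊ + 1 : ℕ) : ℕ∞) : ℝ≥0∞) := by
          rw [ENNReal.ofReal_natCast, ENat.toENNReal_coe]
      _ ≤ _ := ENat.toENNReal_le.2 hT
  have h := measureReal_union_le (μ := callLaw G k)
    {ω | ENNReal.ofReal L ≤ (spreadingTime s ω : ℝ≥0∞)} {ω | informed s ω ⌊L⌋₊ = Set.univ}
  rw [hcover, probReal_univ] at h
  linarith

theorem ae_mem_callees {V : Type*} [Fintype V] [MeasurableSpace V] [DiscreteMeasurableSpace V]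
    (G : SimpleGraph V) (k : ℕ) :
    ∀ᵐ ω ∂callLaw G k, ∀ t v i, ω t v i ∈ callees G v := by
  simp only [ae_all_iff]
  intro t v i
  have hmp := ((measurePreserving_eval (fun _ : Fin k =>
    (PMF.uniformOfFinset (callees G v) (callees_nonempty G v)).toMeasure) i).comp
    (measurePreserving_eval (fun v => Measure.pi fun _ : Fin k =>
      (PMF.uniformOfFinset (callees G v) (callees_nonempty G v)).toMeasure) v)).comp
    (measurePreserving_eval_infinitePi (fun _ : ℕ => roundLaw G k) t)
  refine hmp.quasiMeasurePreserving.ae (p := fun w => w ∈ callees G v) ?_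
  rw [ae_iff, PMF.toMeasure_apply_eq_zero_iff _ .of_discrete, PMF.support_uniformOfFinset]
  exact Set.disjoint_left.2 fun w hw hw' => hw' hw

open Classical in
/-- The informed set grows by at most one graph neighbourhood per round, as long as all calls go to
admissible callees; the definition of `Calls` alone does not force this. -/
theorem ncard_informed_le {V : Type*} [Fintype V] (G : SimpleGraph V) {D : ℕ}
    (hD : ∀ v, G.degree v ≤ D) {k : ℕ} (s : V) {ω : Calls V k}
    (hω : ∀ t v i, ω t v i ∈ callees G v) (t : ℕ) : (informed s ω t).ncard ≤ (1 + D) ^ t := by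
  induction t with
  | zero => simp [informed]
  | succ t ih =>
    have hcall {v w : V} (h : w ∈ callees G v) : w = v ∨ G.Adj v w := by
      unfold callees at h
      split_ifs at h
      · exact Or.inr (by simpa using h)
      · exact Or.inl (by simpa using h)
    have hsub : informed s ω (t + 1) ⊆
        ((informed s ω t).toFinset.biUnion fun u => insert u (G.neighborFinset u) : Finset V) := by
      have key {u v : V} (hu : u ∈ informed s ω t) (h : v = u ∨ G.Adj u v) : v ∈
          (((informed s ω t).toFinset.biUnion fun u => insert u (G.neighborFinset u) :
            Finset V) : Set V) := by
        simp only [Finset.coe_biUnion, Set.mem_iUnion, Finset.mem_coe, Finset.mem_insert,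
          SimpleGraph.mem_neighborFinset, Set.mem_toFinset]
        exact ⟨u, hu, h⟩
      rintro v ((hv | ⟨u, hu, i, rfl⟩) | ⟨i, hi⟩)
      · exact key hv (Or.inl rfl)
      · exact key hu (hcall (hω t u i))
      · exact key hi ((hcall (hω t v i)).imp Eq.symm SimpleGraph.Adj.symm)
    calc (informed s ω (t + 1)).ncard
        ≤ ((informed s ω t).toFinset.biUnion fun u => insert u (G.neighborFinset u)).card := by
          rw [← Set.ncard_coe_finset]
          exact Set.ncard_le_ncard hsub
      _ ≤ (informed s ω t).toFinset.card * (1 + D) := by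
          refine Finset.card_biUnion_le_card_mul _ _ _ fun u _ => ?_
          refine (Finset.card_insert_le _ _).trans ?_
          rw [SimpleGraph.card_neighborFinset_eq_degree, add_comm]
          gcongr
          exact hD u
      _ ≤ (1 + D) ^ (t + 1) := by
          rw [← Set.ncard_eq_toFinset_card', pow_succ]
          gcongr

open Classical in
theorem callLaw_informed_eq_univ_eq_zero {V : Type*} [Fintype V] [MeasurableSpace V]
    [DiscreteMeasurableSpace V] (G : SimpleGraph V) (k : ℕ) {D : ℕ} (hD : ∀ v, G.degree v ≤ D)
    (s : V) {t : ℕ} (ht : (1 + D) ^ t < Fintype.card V) :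
    (callLaw G k).real {ω | informed s ω t = Set.univ} = 0 := by
  rw [measureReal_eq_zero_iff]
  refine measure_mono_null (fun ω hω => ?_) (ae_iff.1 (ae_mem_callees G k))
  intro hall
  have h := ncard_informed_le G hD s hall t
  rw [show informed s ω t = Set.univ from hω, Set.ncard_univ, Nat.card_eq_fintype_card] at h
  omega

/-! ### Real estimates and the lower bound -/

theorem eventually_exp_one_sub_sqrt_le (γ : ℝ) :
    ∀ᶠ n : ℕ in Filter.atTop, Real.exp (1 - √n) ≤ (n : ℝ) ^ (-γ) := by
  have h := (tendsto_rpow_mul_exp_neg_mul_atTop_nhds_zero (2 * γ) 1 one_pos).comp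
    (Real.tendsto_sqrt_atTop.comp tendsto_natCast_atTop_atTop)
  filter_upwards [h.eventually_lt_const (Real.exp_pos (-1)), Filter.eventually_gt_atTop 0]
    with n hn hpos
  have hn0 : (0 : ℝ) < n := by exact_mod_cast hpos
  simp only [Function.comp_apply] at hn
  rw [Real.sqrt_eq_rpow, ← Real.rpow_mul hn0.le, ← Real.sqrt_eq_rpow,
    show 1 / 2 * (2 * γ) = γ by ring, neg_one_mul] at hn
  rw [Real.rpow_neg hn0.le, ← one_div, le_div_iff₀ (by positivity), sub_eq_add_neg, Real.exp_add]
  calc Real.exp 1 * Real.exp (-√n) * (n : ℝ) ^ γ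
      = Real.exp 1 * ((n : ℝ) ^ γ * Real.exp (-√n)) := by ring
    _ ≤ Real.exp 1 * Real.exp (-1) := by gcongr
    _ = 1 := by rw [← Real.exp_add]; simp

theorem IsVertexExpander.mono_right {V : Type*} [Fintype V] {G : SimpleGraph V} {φ α β : ℝ}
    (h : IsVertexExpander G φ β) (hαβ : α ≤ β) : IsVertexExpander G φ α :=
  fun S hS hSn => h S hS (hSn.trans (by gcongr))

/-- Growth by a factor `a`, polynomially bounded in `y`, for fewer than `c * log_y x` rounds gives
at most a small power of `x`. -/
theorem pow_floor_logb_le_rpow {a b x y c A : ℝ} (hx : 1 ≤ x) (hy : 1 < y) (ha : 1 ≤ a)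
    (hab : Real.log a ≤ A * Real.log y) (hb : b ≤ c * Real.logb y x) (hb0 : 0 ≤ b) :
    a ^ ⌊b⌋₊ ≤ x ^ (c * A) := by
  have hly := Real.log_pos hy
  have hlx := Real.log_nonneg hx
  rw [← Real.log_le_log_iff (by positivity) (by positivity), Real.log_pow,
    Real.log_rpow (by positivity)]
  calc (⌊b⌋₊ : ℝ) * Real.log a ≤ (c * Real.logb y x) * (A * Real.log y) := by
        have h1 := Nat.floor_le hb0
        have h2 := Real.log_nonneg ha
        exact mul_le_mul (h1.trans hb) hab h2 (hb0.trans hb)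
    _ = c * A * Real.log x := by
        rw [Real.logb]
        field_simp

/-- For `y` bounded away from `1`, the linear factor `1 + B * y` is at most a fixed power of `y`;
this is where `φ₀ > 1` enters. -/
theorem log_one_add_mul_le {y₀ y B : ℝ} (hy₀ : 1 < y₀) (hy : y₀ ≤ y) (hB : 0 ≤ B) :
    Real.log (1 + B * y) ≤ (1 + Real.log (1 + B) / Real.log y₀) * Real.log y := by
  have h0 := Real.log_pos hy₀
  have hy0 : 0 < y := by linarith
  have h1 : Real.log (1 + B * y) ≤ Real.log ((1 + B) * y) := by
    apply Real.log_le_log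
    · positivity
    · nlinarith
  rw [Real.log_mul (by positivity) hy0.ne'] at h1
  have h2 : Real.log y₀ ≤ Real.log y := Real.log_le_log (by linarith) hy
  have h3 : Real.log (1 + B) ≤ Real.log (1 + B) / Real.log y₀ * Real.log y := by
    rw [div_mul_eq_mul_div, le_div_iff₀ h0]
    have := Real.log_nonneg (show 1 ≤ 1 + B by linarith)
    gcongr
  linarith

theorem theorem2 (φ₀ : ℝ) (hφ₀ : 1 < φ₀) (γ : ℝ) (hγ : 0 < γ) :
    ∃ c : ℝ, 0 < c ∧
      ∀ (n : ℕ) (φ α : ℝ) (k : ℕ), 1 ≤ n → φ₀ ≤ φ → α ≤ 1 / (1 + 1.6 * φ) → 2 ≤ k →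
        ∃ G : SimpleGraph (Fin n), IsVertexExpander G φ α ∧
          ∀ s : Fin n,
            1 - (n : ℝ) ^ (-γ) ≤
              (callLaw G k).real
                {ω | ENNReal.ofReal (c * (Real.logb φ n + Real.logb k n)) ≤
                  (spreadingTime s ω : ℝ≥0∞)} := by
  classical
  obtain ⟨N, hN⟩ := Filter.eventually_atTop.1 (eventually_exp_one_sub_sqrt_le γ)
  set A : ℝ := 1 + Real.log (1 + 58) / Real.log φ₀ with hA
  set B : ℝ := 1 + Real.log (1 + (1 + 2 * 58)) / Real.log 2 with hB
  have hlφ₀ := Real.log_pos hφ₀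
  have hl2 := Real.log_pos one_lt_two
  have hA1 : 0 < A := by positivity
  have hB1 : 0 < B := by positivity
  have hN0 : (0 : ℝ) < Real.log (N + 2) := Real.log_pos (by linarith [N.cast_nonneg (α := ℝ)])
  -- The first two terms keep `|I_t|` below a fixed root of `n`; the third makes the time bound
  -- smaller than one round for the `n < N` at which the tail estimate is not yet below `n ^ (-γ)`.
  refine ⟨min (min (1 / (4 * A)) (1 / (4 * B))) (Real.log 2 / (4 * Real.log (N + 2))),
    by positivity, ?_⟩
  set c : ℝ := min (min (1 / (4 * A)) (1 / (4 * B))) (Real.log 2 / (4 * Real.log (N + 2)))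
    with hc
  have hc0 : 0 < c := by positivity
  have hcA : 2 * c * A ≤ 1 / 2 := by
    have : c ≤ 1 / (4 * A) := (min_le_left _ _).trans (min_le_left _ _)
    rw [le_div_iff₀ (by positivity)] at this
    linarith
  have hcB : 2 * c * B ≤ 1 / 2 := by
    have : c ≤ 1 / (4 * B) := (min_le_left _ _).trans (min_le_right _ _)
    rw [le_div_iff₀ (by positivity)] at this
    linarith
  have hcN : 4 * c * Real.log (N + 2) ≤ Real.log 2 := by
    have : c ≤ Real.log 2 / (4 * Real.log (N + 2)) := min_le_right _ _
    rw [le_div_iff₀ (by positivity)] at this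
    linarith
  clear_value c
  intro n φ α k hn hφ hα hk
  obtain ⟨G, hG, hdeg, hinv⟩ := exists_isVertexExpander n (hφ₀.le.trans hφ)
  refine ⟨G, hG.mono_right hα, fun s => ?_⟩
  refine le_trans ?_ (one_sub_le_measure_spreadingTime G k s _)
  rcases hn.eq_or_lt with rfl | hn2
  · simp
  have hφ1 : 1 < φ := hφ₀.trans_le hφ
  have hk2 : (2 : ℝ) ≤ k := by exact_mod_cast hk
  have hk1 : (1 : ℝ) < k := by linarith
  have hn1 : (1 : ℝ) < n := by exact_mod_cast hn2
  have hln := Real.log_pos hn1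
  have hlφ := Real.log_pos hφ1
  have hlk := Real.log_pos hk1
  set L := c * (Real.logb φ n + Real.logb k n) with hL
  have hL0 : 0 ≤ L := by
    rw [hL, Real.logb, Real.logb]
    positivity
  have hnγ : 0 ≤ (n : ℝ) ^ (-γ) := by positivity
  have hhalf : (n : ℝ) ^ (1 / 2 : ℝ) = √n := (Real.sqrt_eq_rpow _).symm
  refine sub_le_sub_left ?_ 1
  -- For `φ ≤ k` the term `log_φ n` dominates, and bounded degree suffices; for `k < φ` the term
  -- `log_k n` dominates, and the exponential-moment bound is needed.
  rcases le_or_gt φ k with hφk | hkφ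
  · have hlog : Real.logb k n ≤ Real.logb φ n := by
      rw [Real.logb, Real.logb]
      gcongr
    have hpow := pow_floor_logb_le_rpow (a := 1 + 58 * φ) (c := 2 * c) hn1.le hφ1 (by linarith)
      (log_one_add_mul_le hφ₀ hφ (by norm_num))
      (b := L) (by rw [hL]; nlinarith) hL0
    rw [callLaw_informed_eq_univ_eq_zero G k (D := ⌊58 * φ⌋₊)
      (fun v => Nat.le_floor (hdeg v)) s]
    · exact hnγ
    rw [Fintype.card_fin]
    have : ((1 + ⌊58 * φ⌋₊ : ℕ) : ℝ) ^ ⌊L⌋₊ < n := by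
      calc ((1 + ⌊58 * φ⌋₊ : ℕ) : ℝ) ^ ⌊L⌋₊ ≤ (1 + 58 * φ) ^ ⌊L⌋₊ := by
            push_cast
            gcongr
            exact Nat.floor_le (by positivity)
        _ ≤ (n : ℝ) ^ (2 * c * A) := hpow
        _ < (n : ℝ) ^ (1 : ℝ) := Real.rpow_lt_rpow_of_exponent_lt hn1 (by linarith)
        _ = n := Real.rpow_one _
    exact_mod_cast this
  · have hlog : Real.logb φ n ≤ Real.logb k n := by
      rw [Real.logb, Real.logb]
      gcongr
    have hLk : L ≤ 2 * c * Real.logb k n := by rw [hL]; nlinarith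
    rcases lt_or_ge n N with hnN | hnN
    · have hfloor : ⌊L⌋₊ = 0 := by
        rw [Nat.floor_eq_zero]
        refine hLk.trans_lt ?_
        rw [Real.logb, ← mul_div_assoc, div_lt_one hlk]
        have h1 : Real.log n ≤ Real.log (N + 2) := by
          have : (n : ℝ) ≤ N := by exact_mod_cast hnN.le
          gcongr
          linarith
        have h2 : Real.log 2 ≤ Real.log k := by gcongr
        nlinarith
      have hempty : {ω : Calls (Fin n) k | informed s ω ⌊L⌋₊ = Set.univ} = ∅ := by
        rw [hfloor]
        refine Set.eq_empty_of_forall_notMem fun ω (hω : {s} = Set.univ) => ?_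
        have := congrArg Set.ncard hω
        rw [Set.ncard_singleton, Set.ncard_univ, Nat.card_fin] at this
        omega
      rw [hempty, measureReal_empty]
      exact hnγ
    · have hpow := pow_floor_logb_le_rpow (a := 1 + (1 + 2 * 58) * (k : ℝ)) (c := 2 * c) hn1.le hk1
        (by linarith)
        (log_one_add_mul_le one_lt_two hk2 (by norm_num)) hLk hL0
      have hsqrt : (1 + (1 + 2 * 58) * (k : ℝ)) ^ ⌊L⌋₊ ≤ √n := by
        rw [← hhalf]
        exact hpow.trans (Real.rpow_le_rpow_of_exponent_le hn1.le hcB)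
      refine (callLaw_informed_eq_univ_le G k (by norm_num) hinv s ⌊L⌋₊).trans ?_
      refine le_trans (Real.exp_le_exp.2 ?_) (hN n hnN)
      rw [Fintype.card_fin]
      refine sub_le_sub_left ?_ 1
      rw [le_div_iff₀ (by positivity)]
      calc √n * (1 + (1 + 2 * 58) * (k : ℝ)) ^ ⌊L⌋₊ ≤ √n * √n := by gcongr
        _ = n := Real.mul_self_sqrt (by positivity)
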